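/- Notation. For complex lists $a=(a_1,\dots,a_p)$, $b=(b_1,\dots,b_q)$ and $z>0$, the Meijer G-function is $$G^{m,n}_{p,q}\left(z\,\middle|\,\begin{matrix}a_1,\dots,a_p\\ b_1,\dots,b_q\end{matrix}\right)=\frac1{2\pi i}\int_{c-i\infty}^{c+i\infty}\frac{\prod_{j\le m}\Gamma(b_j-s)\prod_{j\le n}\Gamma(1-a_j+s)}{\prod_{j>m}\Gamma(1-b_j+s)\prod_{j>n}\Gamma(a_j-s)}\,z^s\,ds ,$$ where the line $\operatorname{Re}s=c$ has the poles of the $\Gamma(b_j-s)$, $j\le m$, to its right and the poles of the $\Gamma(1-a_j+s)$, $j\le n$, to its left. For a random SNR $\gamma$ with cumulative distribution function $F_\gamma$, the average bit error probability (BEP) of BPSK is $P_{\rm be}=\mathbb E\,[Q(\sqrt{2\gamma})]$, where $Q(x)=\Pr(Z>x)$ for a standard normal $Z$. Let $m_1,m_2,\Omega>0$, and let $N_1,N_2$ be random variables (multipath fading coefficients) such that $N_j^2$ has the density $\frac{m_j^{m_j}x^{m_j-1}}{\Omega^{m_j}\Gamma(m_j)}e^{-m_jx/\Omega}$, $x>0$.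 An inverse gamma variable with shape $\alpha>1$ and scale $g>0$ has the density $\frac{g^{\alpha}}{\Gamma(\alpha)y^{\alpha+1}}e^{-g/y}$, $y>0$. (1) Double shadowing. Let $I_1,I_2$ be inverse gamma with shapes $\alpha_1,\alpha_2>1$ and scales $\overline\gamma_1,\overline\gamma_2>0$, let $N_1,N_2,I_1,I_2$ be independent, and let $\gamma=N_1^2I_1N_2^2I_2$. Put $\overline\gamma=\overline\gamma_1\overline\gamma_2$, $\tilde\gamma=\frac{m_1m_2}{\Omega^2\overline\gamma}$ (that is, $m_1m_2/\overline\gamma$ under the normalization $\Omega=1$) and $\mathcal S_1=\frac1{\Gamma(m_1)\Gamma(m_2)\Gamma(\alpha_1)\Gamma(\alpha_2)}$. Then the integral and the G-function below converge (absolutely, the latter along every separating vertical line, of which there is at least one, and with the same value along each), and $$P_{\rm be}=\frac1{2\sqrt\pi}\int_0^\infty F_\gamma(x)\,x^{-1/2}e^{-x}\,dx=\frac{\mathcal S_1}{2\sqrt\pi}\;G^{2,4}_{4,3}\left(\tilde\gamma\,\middle|\,\begin{matrix}1-\alpha_2,\,1-\alpha_1,\,1,\,\tfrac12\\ m_1,\,m_2,\,0\end{matrix}\right).$$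 (2) Single shadowing. Let $I$ be inverse gamma with shape $\alpha>1$ and scale $\overline\gamma>0$, let $N_1,N_2,I$ be independent, and let $\gamma=(N_1N_2)^2I$. Put $\tilde\gamma=\frac{m_1m_2}{\Omega^2\overline\gamma}$ and $\mathcal S_2=\frac1{\Gamma(m_1)\Gamma(m_2)\Gamma(\alpha)}$. Then, with convergence as in (1), $$P_{\rm be}=\frac1{2\sqrt\pi}\int_0^\infty F_\gamma(x)\,x^{-1/2}e^{-x}\,dx=\frac{\mathcal S_2}{2\sqrt\pi}\;G^{2,3}_{3,3}\left(\tilde\gamma\,\middle|\,\begin{matrix}1-\alpha,\,1,\,\tfrac12\\ m_1,\,m_2,\,0\end{matrix}\right).$$ -/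

import Mathlib

open MeasureTheory ProbabilityTheory

noncomputable section

/-! ### The Meijer G-function -/

/-- The Mellin--Barnes integrand of `G^{m,n}_{p,q}(z | a₁,…,a_p ; b₁,…,b_q)`:
`∏_{j≤m} Γ(b_j - s) ∏_{j≤n} Γ(1 - a_j + s) / (∏_{j>m} Γ(1 - b_j + s) ∏_{j>n} Γ(a_j - s)) * z^s`,
where `p = a.length`, `q = b.length`. (`Complex.Gamma` is `0` at the poles of `Γ`, so that its
inverse is the entire function `1/Γ` also there.) -/
def meijerIntegrand (m n : ℕ) (a b : List ℂ) (z s : ℂ) : ℂ :=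
  ((b.take m).map fun β => Complex.Gamma (β - s)).prod
    * ((a.take n).map fun α => Complex.Gamma (1 - α + s)).prod
    / (((b.drop m).map fun β => Complex.Gamma (1 - β + s)).prod
      * ((a.drop n).map fun α => Complex.Gamma (α - s)).prod)
    * z ^ s

/-- The vertical line `Re s = c` separates the poles `b_j + k` of the `Γ(b_j - s)`, `j ≤ m`
(they lie to the right of it), from the poles `a_j - 1 - k` of the `Γ(1 - a_j + s)`, `j ≤ n`
(they lie to the left of it). -/
def MeijerSeparates (m n : ℕ) (a b : List ℂ) (c : ℝ) : Prop :=
  (∀ β ∈ b.take m, ∀ k : ℕ, c < (β + k).re) ∧ (∀ α ∈ a.take n, ∀ k : ℕ, (α - 1 - k).re < c)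

/-- `G^{m,n}_{p,q}(z | a ; b) = w` in the sense of the Mellin--Barnes integral
`(1 / 2πi) ∫ ds` along a vertical line from `c - i∞` to `c + i∞`: there is a separating vertical
line, and along every such line the integral converges absolutely and has the value `w`. -/
structure HasMeijerG (m n : ℕ) (a b : List ℂ) (z w : ℂ) : Prop where
  exists_separates : ∃ c : ℝ, MeijerSeparates m n a b c
  integrable : ∀ c : ℝ, MeijerSeparates m n a b c →
    Integrable fun t : ℝ => meijerIntegrand m n a b z (c + t * Complex.I)
  integral_eq : ∀ c : ℝ, MeijerSeparates m n a b c →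
    (1 / (2 * Real.pi) : ℂ) * ∫ t : ℝ, meijerIntegrand m n a b z (c + t * Complex.I) = w

open Classical in
/-- The Meijer G-function `G^{m,n}_{p,q}(z | a ; b)` (with value `0` where the Mellin--Barnes
integral along separating vertical lines does not define it). -/
def meijerG (m n : ℕ) (a b : List ℂ) (z : ℂ) : ℂ :=
  if h : ∃ w, HasMeijerG m n a b z w then h.choose else 0

theorem HasMeijerG.unique {m n : ℕ} {a b : List ℂ} {z w w' : ℂ}
    (h : HasMeijerG m n a b z w) (h' : HasMeijerG m n a b z w') : w = w' := by
  obtain ⟨c, hc⟩ := h.exists_separates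
  exact (h.integral_eq c hc).symm.trans (h'.integral_eq c hc)

theorem HasMeijerG.meijerG_eq {m n : ℕ} {a b : List ℂ} {z w : ℂ}
    (h : HasMeijerG m n a b z w) : meijerG m n a b z = w := by
  have hex : ∃ w, HasMeijerG m n a b z w := ⟨w, h⟩
  rw [meijerG, dif_pos hex]
  exact hex.choose_spec.unique h

/-! ### The channel model -/

/-- The law of the squared envelope `N²` under Nakagami-`m` fading with mean square value `Ω`:
density `m^m x^(m-1) / (Ω^m Γ(m)) * exp (-m x / Ω)` on `x > 0`,
which is the gamma law with shape `m` and rate `m / Ω`. -/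
def nakagamiPowerLaw (m Ω : ℝ) : Measure ℝ := gammaMeasure m (m / Ω)

/-- The density of the inverse gamma law with shape `α` and scale `g`. -/
def inverseGammaPDF (α g y : ℝ) : ℝ :=
  if 0 < y then g ^ α / (Real.Gamma α * y ^ (α + 1)) * Real.exp (-(g / y)) else 0

/-- The inverse gamma law with shape `α` and scale `g`. -/
def inverseGammaLaw (α g : ℝ) : Measure ℝ :=
  volume.withDensity fun y => ENNReal.ofReal (inverseGammaPDF α g y)

/-- The double-shadowing scenario: independent Nakagami envelopes `N₁, N₂` and inverse gamma
shadowing coefficients `I₁, I₂`. -/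
structure DoubleShadowing {W : Type*} [MeasurableSpace W] (P : Measure W)
    (N₁ N₂ I₁ I₂ : W → ℝ) (m₁ m₂ Ω α₁ α₂ g₁ g₂ : ℝ) : Prop where
  aemeasurable_N₁ : AEMeasurable N₁ P
  aemeasurable_N₂ : AEMeasurable N₂ P
  law_N₁ : HasLaw (fun w => N₁ w ^ 2) (nakagamiPowerLaw m₁ Ω) P
  law_N₂ : HasLaw (fun w => N₂ w ^ 2) (nakagamiPowerLaw m₂ Ω) P
  law_I₁ : HasLaw I₁ (inverseGammaLaw α₁ g₁) P
  law_I₂ : HasLaw I₂ (inverseGammaLaw α₂ g₂) P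
  indep : iIndepFun ![N₁, N₂, I₁, I₂] P

/-- The single-shadowing scenario: independent Nakagami envelopes `N₁, N₂` and one inverse gamma
shadowing coefficient `I`. -/
structure SingleShadowing {W : Type*} [MeasurableSpace W] (P : Measure W)
    (N₁ N₂ I : W → ℝ) (m₁ m₂ Ω α g : ℝ) : Prop where
  aemeasurable_N₁ : AEMeasurable N₁ P
  aemeasurable_N₂ : AEMeasurable N₂ P
  law_N₁ : HasLaw (fun w => N₁ w ^ 2) (nakagamiPowerLaw m₁ Ω) P
  law_N₂ : HasLaw (fun w => N₂ w ^ 2) (nakagamiPowerLaw m₂ Ω) P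
  law_I : HasLaw I (inverseGammaLaw α g) P
  indep : iIndepFun ![N₁, N₂, I] P

/-- The received SNR in the double-shadowing scenario. -/
def snrDS {W : Type*} (N₁ N₂ I₁ I₂ : W → ℝ) (w : W) : ℝ :=
  (N₁ w ^ 2 * I₁ w) * (N₂ w ^ 2 * I₂ w)

/-- The received SNR in the single-shadowing scenario. -/
def snrSS {W : Type*} (N₁ N₂ I : W → ℝ) (w : W) : ℝ :=
  (N₁ w * N₂ w) ^ 2 * I w

/-! ### Bit error probability of BPSK -/

/-- The Gaussian tail probability `Q(x) = Pr(Z > x)`, `Z` standard normal. -/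
def gaussianQ (x : ℝ) : ℝ := (gaussianReal 0 1).real (Set.Ioi x)

/-- The average bit error probability of (coherent) BPSK over a fading channel with random
instantaneous SNR `γ`: the mean of the conditional error probability `Q(√(2γ))`. -/
def bepBPSK {W : Type*} [MeasurableSpace W] (P : Measure W) (γ : W → ℝ) : ℝ :=
  ∫ w, gaussianQ (Real.sqrt (2 * γ w)) ∂P

/-- The integrand `F(x) x^(-1/2) e^(-x)` of the CDF form of the BPSK bit error probability, where
`F` is the cumulative distribution function of `γ`. -/
def bepIntegrand {W : Type*} [MeasurableSpace W] (P : Measure W) (γ : W → ℝ) (x : ℝ) : ℝ :=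
  cdf (P.map γ) x * x ^ (-(1 / 2) : ℝ) * Real.exp (-x)

end

/-!
Since `Q(√(2y)) = Γ(1/2, y) / (2√π)`, Fubini applied to the tail integral `Γ(1/2, y)` turns the
mean of `Q(√(2γ))` into the integral of the CDF of `γ` against `x^(-1/2) e^(-x) / (2√π)`.

For the Meijer G-function, the Mellin transform of `Γ(a, ·)` is `Γ(s + a) / s`, which is
`O(|s|⁻²)` on every vertical line in the right half-plane because `|Γ|` is bounded there by its
value at the real part. Mellin inversion, again with Fubini, therefore writes `E[Γ(1/2, γ)]` as a
Mellin–Barnes integral of `E[γ^(-s)] Γ(s + 1/2) / s`. For a product of independent gamma and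
inverse gamma variables the moment `E[γ^(-s)]` is a constant times `z^s` times a product of gamma
factors, and `Γ(s + 1/2) / s = Γ(s) Γ(s + 1/2) / Γ(1 + s)` accounts for the parameters
`1, 1/2; 0`.
-/

noncomputable section

open Set Complex Filter Topology

section Mellin

variable {E : Type*} [NormedAddCommGroup E] [NormedSpace ℂ E] {f g : ℝ → E} {s : ℂ} {m : E}

theorem hasMellin_congr (hf : HasMellin f s m) (hfg : EqOn f g (Ioi 0)) : HasMellin g s m := by
  have hcongr : EqOn (fun x : ℝ => (x : ℂ) ^ (s - 1) • f x) (fun x : ℝ => (x : ℂ) ^ (s - 1) • g x)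
      (Ioi 0) := fun x hx => by simp only [hfg hx]
  refine ⟨hf.1.congr_fun hcongr measurableSet_Ioi, ?_⟩
  rw [mellin, ← setIntegral_congr_fun measurableSet_Ioi hcongr]
  exact hf.2

theorem hasMellin_smul (hf : HasMellin f s m) (c : ℂ) :
    HasMellin (fun x => c • f x) s (c • m) :=
  hf.2 ▸ hasMellin_const_smul hf.1 c

theorem hasMellin_comp_inv (hf : HasMellin f (-s) m) : HasMellin (fun x => f x⁻¹) s m := by
  refine ⟨?_, (mellin_comp_inv f s).trans hf.2⟩
  have h := MellinConvergent.comp_rpow (f := f) (s := s) (a := -1) (by norm_num)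
  simp only [Real.rpow_neg_one, ofReal_neg, ofReal_one, div_neg, div_one] at h
  exact h.2 hf.1

theorem hasMellin_cpow_smul {a : ℂ} (hf : HasMellin f (s + a) m) :
    HasMellin (fun x : ℝ => (x : ℂ) ^ a • f x) s m :=
  ⟨MellinConvergent.cpow_smul.2 hf.1, (mellin_cpow_smul f s a).trans hf.2⟩

theorem hasMellin_comp_mul_left {r : ℝ} (hr : 0 < r) (hf : HasMellin f s m) :
    HasMellin (fun x => f (r * x)) s ((r : ℂ) ^ (-s) • m) :=
  ⟨(MellinConvergent.comp_mul_left hr).2 hf.1, by rw [mellin_comp_mul_left f s hr, hf.2]⟩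

end Mellin

theorem hasMellin_exp_neg {s : ℂ} (hs : 0 < s.re) :
    HasMellin (fun x => (Real.exp (-x) : ℂ)) s (Gamma s) := by
  refine ⟨?_, ?_⟩
  · have := GammaIntegral_convergent hs
    simpa only [MellinConvergent, smul_eq_mul, mul_comm] using this
  · rw [← GammaIntegral_eq_mellin, Gamma_eq_integral hs]

theorem hasMellin_rpow_mul_exp_neg_mul {a r : ℝ} (hr : 0 < r) {s : ℂ} (hs : 0 < a + s.re) :
    HasMellin (fun x => ((x ^ a * Real.exp (-(r * x)) : ℝ) : ℂ)) s
      ((r : ℂ) ^ (-(s + a)) * Gamma (s + a)) := by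
  have hre : 0 < (s + a : ℂ).re := by simpa [add_comm] using hs
  refine hasMellin_congr (hasMellin_cpow_smul (hasMellin_comp_mul_left hr (hasMellin_exp_neg hre)))
    fun x hx => ?_
  simp only [smul_eq_mul, ofReal_mul, ofReal_cpow (le_of_lt hx)]

section Primitive

variable {s : ℂ}

theorem integrableOn_Ioo_cpow (hs : 0 < s.re) {x : ℝ} (hx : 0 < x) :
    IntegrableOn (fun y : ℝ => (y : ℂ) ^ (s - 1)) (Ioo 0 x) := by
  rw [← intervalIntegrable_iff_integrableOn_Ioo_of_le hx.le]
  exact intervalIntegral.intervalIntegrable_cpow' (by simpa using hs)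

theorem integral_Ioo_cpow (hs : 0 < s.re) {x : ℝ} (hx : 0 < x) :
    ∫ y in Ioo 0 x, (y : ℂ) ^ (s - 1) = (x : ℂ) ^ s / s := by
  have hs0 : s ≠ 0 := by rintro rfl; simp at hs
  rw [← integral_Ioc_eq_integral_Ioo, ← intervalIntegral.integral_of_le hx.le,
    integral_cpow (Or.inl (by simpa using hs))]
  simp [zero_cpow hs0]

theorem integral_Ioo_norm_cpow (hs : 0 < s.re) {x : ℝ} (hx : 0 < x) :
    ∫ y in Ioo 0 x, ‖(y : ℂ) ^ (s - 1)‖ = x ^ s.re / s.re := by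
  rw [setIntegral_congr_fun (g := fun y : ℝ => y ^ (s.re - 1)) measurableSet_Ioo
    (fun y hy => by simp only [norm_cpow_eq_rpow_re_of_pos hy.1, sub_re, one_re]),
    ← integral_Ioc_eq_integral_Ioo, ← intervalIntegral.integral_of_le hx.le,
    integral_rpow (Or.inl (by linarith))]
  simp [Real.zero_rpow hs.ne']

variable {E : Type*} [NormedAddCommGroup E] [NormedSpace ℂ E] {k : ℝ → E} {m : E}

theorem aestronglyMeasurable_of_mellinConvergent (hk : MellinConvergent k s) :
    AEStronglyMeasurable k (volume.restrict (Ioi 0)) := by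
  have hcpow : AEStronglyMeasurable (fun x : ℝ => (x : ℂ) ^ (1 - s)) (volume.restrict (Ioi 0)) :=
    (by fun_prop : Measurable fun x : ℝ => (x : ℂ) ^ (1 - s)).aestronglyMeasurable
  refine (hcpow.smul hk.aestronglyMeasurable).congr ?_
  filter_upwards [ae_restrict_mem measurableSet_Ioi] with x hx
  have hx0 : (x : ℂ) ≠ 0 := ofReal_ne_zero.2 (ne_of_gt hx)
  rw [Pi.smul_apply', smul_smul, ← cpow_add _ _ hx0, sub_add_sub_cancel, sub_self, cpow_zero,
    one_smul]

/-- The integrand over the region `y < x` of the double integral that gives the Mellin transform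
at `s` of `y ↦ ∫ x in Ioi y, k x`. -/
def mellinPrimitiveIntegrand (k : ℝ → E) (s : ℂ) (y x : ℝ) : E :=
  (Iio x).indicator (fun y : ℝ => (y : ℂ) ^ (s - 1) • k x) y

theorem mellinPrimitiveIntegrand_eq_indicator_Ioi (y : ℝ) :
    mellinPrimitiveIntegrand k s y = (Ioi y).indicator fun x => (y : ℂ) ^ (s - 1) • k x := by
  ext x
  simp only [mellinPrimitiveIntegrand, indicator, mem_Iio, mem_Ioi]

theorem integrable_mellinPrimitiveIntegrand (hs : 0 < s.re) (hk : MellinConvergent k (s + 1)) :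
    Integrable (Function.uncurry (mellinPrimitiveIntegrand k s))
      ((volume.restrict (Ioi 0)).prod (volume.restrict (Ioi 0))) := by
  have hmeas : AEStronglyMeasurable (Function.uncurry (mellinPrimitiveIntegrand k s))
      ((volume.restrict (Ioi 0)).prod (volume.restrict (Ioi 0))) := by
    have hcpow : Measurable fun p : ℝ × ℝ => (p.1 : ℂ) ^ (s - 1) := by fun_prop
    refine ((hcpow.aestronglyMeasurable.smul
      (aestronglyMeasurable_of_mellinConvergent hk).comp_snd).indicator
      (measurableSet_lt measurable_fst measurable_snd)).congr (.of_forall fun p => ?_)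
    simp only [Function.uncurry, mellinPrimitiveIntegrand, indicator, mem_ofPred_eq, mem_Iio,
      Pi.smul_apply']
  rw [integrable_prod_iff' hmeas]
  constructor
  · filter_upwards [ae_restrict_mem measurableSet_Ioi] with x hx
    simp only [Function.uncurry, mellinPrimitiveIntegrand]
    rw [integrable_indicator_iff measurableSet_Iio, IntegrableOn,
      Measure.restrict_restrict measurableSet_Iio, inter_comm, Ioi_inter_Iio]
    exact (integrableOn_Ioo_cpow hs hx).smul_const _
  · refine IntegrableOn.congr_fun (hk.norm.div_const s.re) (fun x hx => ?_) measurableSet_Ioi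
    simp only [Function.uncurry, mellinPrimitiveIntegrand, norm_indicator_eq_indicator_norm,
      norm_smul]
    rw [integral_indicator measurableSet_Iio, Measure.restrict_restrict measurableSet_Iio,
      inter_comm, Ioi_inter_Iio, integral_mul_const, integral_Ioo_norm_cpow hs hx,
      norm_cpow_eq_rpow_re_of_pos hx, add_sub_cancel_right]
    ring

theorem hasMellin_integral_Ioi [CompleteSpace E] (hs : 0 < s.re) (hk : HasMellin k (s + 1) m) :
    HasMellin (fun y => ∫ x in Ioi y, k x) s (s⁻¹ • m) := by
  have hInt := integrable_mellinPrimitiveIntegrand hs hk.1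
  have hinner : ∀ y ∈ Ioi (0 : ℝ), ∫ x in Ioi 0, mellinPrimitiveIntegrand k s y x =
      (y : ℂ) ^ (s - 1) • ∫ x in Ioi y, k x := by
    intro y hy
    rw [mellinPrimitiveIntegrand_eq_indicator_Ioi, integral_indicator measurableSet_Ioi,
      Measure.restrict_restrict measurableSet_Ioi, inter_eq_left.2 (Ioi_subset_Ioi (le_of_lt hy)),
      integral_smul]
  refine ⟨IntegrableOn.congr_fun hInt.integral_prod_left hinner measurableSet_Ioi, ?_⟩
  rw [mellin, ← setIntegral_congr_fun measurableSet_Ioi hinner, integral_integral_swap hInt,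
    ← hk.2, mellin, ← integral_smul]
  refine setIntegral_congr_fun measurableSet_Ioi fun x hx => ?_
  simp only [mellinPrimitiveIntegrand]
  rw [integral_indicator measurableSet_Iio, Measure.restrict_restrict measurableSet_Iio,
    inter_comm, Ioi_inter_Iio, integral_smul_const, integral_Ioo_cpow hs hx, smul_smul,
    add_sub_cancel_right, div_eq_inv_mul]

end Primitive

section GammaVertical

theorem norm_Gamma_le_Gamma_re {s : ℂ} (hs : 0 < s.re) : ‖Gamma s‖ ≤ Real.Gamma s.re := by
  rw [Gamma_eq_integral hs, Real.Gamma_eq_integral hs, GammaIntegral]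
  refine (norm_integral_le_integral_norm _).trans_eq
    (setIntegral_congr_fun measurableSet_Ioi fun x hx => ?_)
  simp only [norm_mul, norm_cpow_eq_rpow_re_of_pos hx, sub_re, one_re, norm_real, Real.norm_eq_abs,
    Real.abs_exp]

theorem norm_le_norm_add_ofReal {a : ℝ} (ha : 0 ≤ a) {s : ℂ} (hs : 0 ≤ s.re) :
    ‖s‖ ≤ ‖s + a‖ := by
  rw [← sq_le_sq₀ (norm_nonneg _) (norm_nonneg _), Complex.sq_norm, Complex.sq_norm, normSq_apply,
    normSq_apply, add_re, add_im, ofReal_re, ofReal_im]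
  nlinarith

theorem norm_Gamma_add_div_le {a : ℝ} (ha : 0 ≤ a) {s : ℂ} (hs : 0 < s.re) :
    ‖Gamma (s + a) / s‖ ≤ Real.Gamma (s.re + a + 1) / ‖s‖ ^ 2 := by
  have hnorm : 0 < ‖s‖ := norm_pos_iff.2 (ne_zero_of_re_pos hs)
  have hre : 0 < (s + a).re := by simpa using add_pos_of_pos_of_nonneg hs ha
  have hshift : ‖s‖ * ‖Gamma (s + a)‖ ≤ Real.Gamma (s.re + a + 1) :=
    calc ‖s‖ * ‖Gamma (s + a)‖ ≤ ‖s + a‖ * ‖Gamma (s + a)‖ := by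
          gcongr; exact norm_le_norm_add_ofReal ha hs.le
      _ = ‖Gamma (s + a + 1)‖ := by rw [Gamma_add_one _ (ne_zero_of_re_pos hre), norm_mul]
      _ ≤ Real.Gamma (s.re + a + 1) :=
          norm_Gamma_le_Gamma_re (s := s + a + 1) (by simpa using hre.trans (lt_add_one _))
  rw [norm_div, div_le_div_iff₀ hnorm (by positivity)]
  nlinarith

theorem continuous_Gamma_vertical {σ : ℝ} (hσ : 0 < σ) :
    Continuous fun t : ℝ => Gamma (σ + t * I) := by
  refine continuous_iff_continuousAt.2 fun t => ?_
  have hΓ : ContinuousAt Gamma (σ + t * I) := continuousAt_Gamma _ fun n hn => by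
    have hre : σ = -n := by simpa using congrArg re hn
    linarith [n.cast_nonneg (α := ℝ)]
  exact ContinuousAt.comp (g := Gamma) (f := fun t : ℝ => (σ + t * I : ℂ)) hΓ (by fun_prop)

theorem integrable_inv_sq_add_sq {σ : ℝ} (hσ : 0 < σ) :
    Integrable fun t : ℝ => (σ ^ 2 + t ^ 2)⁻¹ := by
  refine ((integrable_inv_one_add_sq.comp_div hσ.ne').const_mul (σ ^ 2)⁻¹).congr
    (.of_forall fun t => ?_)
  field_simp

theorem verticalIntegrable_Gamma_add_div {a σ : ℝ} (ha : 0 ≤ a) (hσ : 0 < σ) :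
    VerticalIntegrable (fun s => Gamma (s + a) / s) σ := by
  have hre : ∀ t : ℝ, 0 < (σ + t * I : ℂ).re := fun t => by simpa using hσ
  have hcont : Continuous fun t : ℝ => Gamma (σ + t * I + a) := by
    simpa only [ofReal_add, add_right_comm] using
      continuous_Gamma_vertical (add_pos_of_pos_of_nonneg hσ ha)
  refine ((integrable_inv_sq_add_sq hσ).const_mul (Real.Gamma (σ + a + 1))).mono'
    (hcont.div (by fun_prop) fun t => ne_zero_of_re_pos (hre t)).aestronglyMeasurable
    (.of_forall fun t => ?_)
  simpa only [div_eq_mul_inv, Complex.sq_norm, normSq_add_mul_I, add_re, ofReal_re, re_ofReal_mul,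
    I_re, mul_zero, add_zero] using norm_Gamma_add_div_le ha (hre t)

end GammaVertical

section UpperIncompleteGamma

/-- The upper incomplete gamma function `Γ(a, y)`, for `y > 0`. -/
def upperIncompleteGamma (a y : ℝ) : ℝ := ∫ x in Ioi y, x ^ (a - 1) * Real.exp (-x)

variable {a : ℝ}

theorem hasMellin_upperIncompleteGamma {s : ℂ} (hs : 0 < s.re) (has : 0 < a + s.re) :
    HasMellin (fun y => (upperIncompleteGamma a y : ℂ)) s (Gamma (s + a) / s) := by
  have hkernel := hasMellin_rpow_mul_exp_neg_mul (a := a - 1) (s := s + 1) one_pos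
    (by rw [add_re, one_re]; linarith)
  have hexp : s + 1 + ((a - 1 : ℝ) : ℂ) = s + a := by push_cast; ring
  simp only [one_mul, ofReal_one, one_cpow, hexp] at hkernel
  simpa only [upperIncompleteGamma, ← integral_complex_ofReal, smul_eq_mul, div_eq_inv_mul]
    using hasMellin_integral_Ioi hs hkernel

theorem integrableOn_rpow_mul_exp_neg (ha : 0 < a) :
    IntegrableOn (fun x : ℝ => x ^ (a - 1) * Real.exp (-x)) (Ioi 0) := by
  simpa only [mul_comm] using Real.GammaIntegral_convergent ha

theorem continuousAt_upperIncompleteGamma (ha : 0 < a) {y : ℝ} (hy : 0 < y) :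
    ContinuousAt (upperIncompleteGamma a) y :=
  (integrableOn_rpow_mul_exp_neg ha).continuousOn_Ici_primitive_Ioi.continuousAt (Ici_mem_nhds hy)

theorem integral_cpow_mul_Gamma_add_div (ha : 0 < a) {c y : ℝ} (hc : 0 < c) (hy : 0 < y) :
    (1 / (2 * Real.pi) : ℂ) * ∫ t : ℝ, (y : ℂ) ^ (-(c + t * I))
      * (Gamma (c + t * I + a) / (c + t * I)) = upperIncompleteGamma a y := by
  have hmellin : ∀ t : ℝ, HasMellin (fun y => (upperIncompleteGamma a y : ℂ)) (c + t * I)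
      (Gamma (c + t * I + a) / (c + t * I)) := fun t =>
    hasMellin_upperIncompleteGamma (by simpa using hc) (by simpa using add_pos ha hc)
  have hvert : VerticalIntegrable (mellin fun y => (upperIncompleteGamma a y : ℂ)) c :=
    (verticalIntegrable_Gamma_add_div ha.le hc).congr (.of_forall fun t => (hmellin t).2.symm)
  have hconv : MellinConvergent (fun y => (upperIncompleteGamma a y : ℂ)) c := by
    simpa using (hmellin 0).1
  rw [← mellinInv_mellin_eq c _ hy hconv hvert
    (continuous_ofReal.continuousAt.comp (continuousAt_upperIncompleteGamma ha hy)), mellinInv]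
  simp only [fun t => (hmellin t).2, smul_eq_mul, real_smul, ofReal_div, ofReal_mul, ofReal_one,
    ofReal_ofNat]

end UpperIncompleteGamma

section ComplexMoment

variable {W : Type*} [MeasurableSpace W] {P : Measure W}

/-- `E[X ^ s] = M` with absolute convergence, for an almost surely positive random variable `X`
and a complex exponent `s`. -/
structure HasComplexMoment (P : Measure W) (X : W → ℝ) (s M : ℂ) : Prop where
  integrable : Integrable (fun w => (X w : ℂ) ^ s) P
  integral_eq : ∫ w, (X w : ℂ) ^ s ∂P = M

section Density

variable {X : W → ℝ} {p : ℝ → ℝ}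

theorem ae_pos_of_hasLaw_withDensity (hp : Measurable p) (hp_neg : ∀ x < 0, p x = 0)
    (hX : HasLaw X (volume.withDensity fun x => ENNReal.ofReal (p x)) P) : ∀ᵐ w ∂P, 0 < X w := by
  rw [hX.ae_iff (p := fun x => 0 < x) (measurableSet_Ioi (a := (0 : ℝ))).mem,
    ae_withDensity_iff hp.ennreal_ofReal]
  filter_upwards [Measure.ae_ne volume (0 : ℝ)] with x hx0 hpx
  by_contra hx
  simp [hp_neg x ((not_lt.1 hx).lt_of_ne hx0)] at hpx

theorem hasComplexMoment_of_hasLaw_withDensity (hp : Measurable p) (hp_nonneg : ∀ x, 0 ≤ p x)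
    (hp_neg : ∀ x < 0, p x = 0)
    (hX : HasLaw X (volume.withDensity fun x => ENNReal.ofReal (p x)) P) {s M : ℂ}
    (hM : HasMellin (fun x => (p x : ℂ)) (s + 1) M) : HasComplexMoment P X s M := by
  have hcpow : Measurable fun x : ℝ => (x : ℂ) ^ s := by fun_prop
  have hdensity : (fun x : ℝ => (ENNReal.ofReal (p x)).toReal • (x : ℂ) ^ s) =ᵐ[volume]
      (Ioi (0 : ℝ)).indicator fun x : ℝ => (x : ℂ) ^ (s + 1 - 1) • (p x : ℂ) := by
    filter_upwards [Measure.ae_ne volume (0 : ℝ)] with x hx0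
    rw [ENNReal.toReal_ofReal (hp_nonneg x), real_smul, add_sub_cancel_right, mul_comm]
    rcases hx0.lt_or_gt with hx | hx
    · simp [hp_neg x hx, hx.not_gt]
    · simp [hx]
  constructor
  · refine Integrable.comp_aemeasurable (g := fun x : ℝ => (x : ℂ) ^ s) ?_ hX.aemeasurable
    rw [hX.map_eq, integrable_withDensity_iff_integrable_smul' hp.ennreal_ofReal (by simp),
      integrable_congr hdensity, integrable_indicator_iff measurableSet_Ioi]
    exact hM.1
  · calc ∫ w, (X w : ℂ) ^ s ∂P
        = ∫ x, (x : ℂ) ^ s ∂volume.withDensity fun x => ENNReal.ofReal (p x) :=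
          hX.integral_comp hcpow.aestronglyMeasurable
      _ = M := by
          rw [integral_withDensity_eq_integral_toReal_smul hp.ennreal_ofReal (by simp),
            integral_congr_ae hdensity, integral_indicator measurableSet_Ioi]
          exact hM.2

end Density

theorem cpow_ofReal_prod {ι : Type*} (t : Finset ι) {x : ι → ℝ} (hx : ∀ i ∈ t, 0 ≤ x i)
    (s : ℂ) : ((∏ i ∈ t, x i : ℝ) : ℂ) ^ s = ∏ i ∈ t, (x i : ℂ) ^ s := by
  classical
  induction t using Finset.induction_on with
  | empty => simp
  | insert i t hi ih =>
    rw [Finset.forall_mem_insert] at hx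
    rw [Finset.prod_insert hi, Finset.prod_insert hi, ofReal_mul,
      mul_cpow_ofReal_nonneg hx.1 (Finset.prod_nonneg hx.2), ih hx.2]

theorem integrable_prod_of_iIndepFun {ι : Type*} [Fintype ι] {X : ι → W → ℂ}
    (hX : iIndepFun X P) (hX_int : ∀ i, Integrable (X i) P) :
    Integrable (fun w => ∏ i, X i w) P := by
  have := hX.isProbabilityMeasure
  have hX_meas : ∀ i, AEMeasurable (X i) P := fun i => (hX_int i).aemeasurable
  have := fun i => Measure.isProbabilityMeasure_map (hX_meas i)
  have hpi : Integrable (fun x : ι → ℂ => ∏ i, x i) (Measure.pi fun i => P.map (X i)) :=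
    Integrable.fintype_prod (f := fun _ x => x) fun i =>
      (integrable_map_measure aestronglyMeasurable_id (hX_meas i)).2 (hX_int i)
  rw [← hX.map_fun_eq_pi_map hX_meas] at hpi
  exact hpi.comp_aemeasurable (aemeasurable_pi_lambda _ hX_meas)

theorem hasComplexMoment_prod {ι : Type*} [Fintype ι] {X : ι → W → ℝ} {s : ℂ} {M : ι → ℂ}
    (hX : iIndepFun X P) (hX_pos : ∀ i, ∀ᵐ w ∂P, 0 < X i w)
    (hM : ∀ i, HasComplexMoment P (X i) s (M i)) :
    HasComplexMoment P (fun w => ∏ i, X i w) s (∏ i, M i) := by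
  have hcpow : Measurable fun x : ℝ => (x : ℂ) ^ s := by fun_prop
  have hindep : iIndepFun (fun i w => (X i w : ℂ) ^ s) P := hX.comp _ fun _ => hcpow
  have hae : (fun w => ∏ i, (X i w : ℂ) ^ s) =ᵐ[P] fun w => ((∏ i, X i w : ℝ) : ℂ) ^ s := by
    filter_upwards [ae_all_iff.2 hX_pos] with w hw
    rw [cpow_ofReal_prod _ fun i _ => (hw i).le]
  refine ⟨(integrable_prod_of_iIndepFun hindep fun i => (hM i).integrable).congr hae, ?_⟩
  rw [← integral_congr_ae hae,
    hindep.integral_fun_prod_eq_prod_integral fun i => (hM i).integrable.aestronglyMeasurable]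
  exact Finset.prod_congr rfl fun i _ => (hM i).integral_eq

end ComplexMoment

section GammaLaws

theorem hasMellin_gammaPDFReal {a r : ℝ} (hr : 0 < r) {s : ℂ} (hs : s.re < a) :
    HasMellin (fun x => (gammaPDFReal a r x : ℂ)) (-s + 1)
      (Gamma (a - s) / (Real.Gamma a : ℂ) * (r : ℂ) ^ s) := by
  have hr0 : (r : ℂ) ≠ 0 := ofReal_ne_zero.2 hr.ne'
  have hbase := hasMellin_smul (hasMellin_rpow_mul_exp_neg_mul (a := a - 1) (s := -s + 1) hr
    (by rw [add_re, neg_re, one_re]; linarith)) ((r : ℂ) ^ (a : ℂ) / (Real.Gamma a : ℂ))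
  have hvalue : ((r : ℂ) ^ (a : ℂ) / (Real.Gamma a : ℂ)) •
      ((r : ℂ) ^ (-(-s + 1 + (a - 1 : ℝ))) * Gamma (-s + 1 + (a - 1 : ℝ))) =
      Gamma (a - s) / (Real.Gamma a : ℂ) * (r : ℂ) ^ s := by
    have hpow : (r : ℂ) ^ (a : ℂ) * (r : ℂ) ^ (s - a) = (r : ℂ) ^ s := by
      rw [← cpow_add _ _ hr0, add_sub_cancel]
    rw [show -s + 1 + ((a - 1 : ℝ) : ℂ) = a - s by push_cast; ring, neg_sub, ← hpow, smul_eq_mul]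
    ring
  refine hvalue ▸ hasMellin_congr hbase fun x hx => ?_
  have hx0 : 0 ≤ x := le_of_lt hx
  simp only [gammaPDFReal, if_pos hx0, smul_eq_mul, ofReal_mul, ofReal_div,
    ofReal_cpow hr.le, mul_assoc]

theorem inverseGammaPDF_eq_gammaPDFReal_inv {α g x : ℝ} (hx : 0 < x) :
    inverseGammaPDF α g x = x ^ (-2 : ℝ) * gammaPDFReal α g x⁻¹ := by
  rw [inverseGammaPDF, if_pos hx, gammaPDFReal, if_pos (inv_nonneg.2 hx.le),
    Real.inv_rpow hx.le, ← Real.rpow_neg hx.le, show α + 1 = -(-2 + -(α - 1)) by ring,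
    Real.rpow_neg hx.le, Real.rpow_add hx]
  have : x ^ (-2 : ℝ) ≠ 0 := by positivity
  have : x ^ (-(α - 1)) ≠ 0 := by positivity
  field_simp

theorem hasMellin_inverseGammaPDF {α g : ℝ} (hg : 0 < g) {s : ℂ} (hs : -α < s.re) :
    HasMellin (fun x => (inverseGammaPDF α g x : ℂ)) (-s + 1)
      (Gamma (α + s) / (Real.Gamma α : ℂ) * ((g⁻¹ : ℝ) : ℂ) ^ s) := by
  have hgamma := hasMellin_gammaPDFReal hg (s := -s) (a := α) (by rw [neg_re]; linarith)
  have hinv : HasMellin (fun x : ℝ => (x : ℂ) ^ (-2 : ℂ) • (gammaPDFReal α g x⁻¹ : ℂ)) (-s + 1)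
      (Gamma (α - -s) / (Real.Gamma α : ℂ) * (g : ℂ) ^ (-s)) := by
    refine hasMellin_cpow_smul (hasMellin_comp_inv (f := fun x => (gammaPDFReal α g x : ℂ)) ?_)
    convert hgamma using 1; ring
  rw [sub_neg_eq_add, cpow_neg, ← inv_cpow _ _ (by simp [arg_ofReal_of_nonneg hg.le,
    Real.pi_ne_zero.symm]), ← ofReal_inv] at hinv
  refine hasMellin_congr hinv fun x hx => ?_
  simp only [inverseGammaPDF_eq_gammaPDFReal_inv hx, smul_eq_mul, ofReal_mul,
    ofReal_cpow (le_of_lt hx)]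
  norm_num

theorem inverseGammaPDF_nonneg {α g : ℝ} (hα : 0 < α) (hg : 0 < g) (x : ℝ) :
    0 ≤ inverseGammaPDF α g x := by
  unfold inverseGammaPDF
  split_ifs
  · have := Real.Gamma_pos_of_pos hα
    positivity
  · rfl

theorem measurable_inverseGammaPDF (α g : ℝ) : Measurable (inverseGammaPDF α g) :=
  Measurable.ite measurableSet_Ioi (by fun_prop) measurable_const

theorem inverseGammaPDF_of_neg (α g : ℝ) {x : ℝ} (hx : x < 0) : inverseGammaPDF α g x = 0 :=
  if_neg hx.not_gt

theorem gammaPDFReal_of_neg (a r : ℝ) {x : ℝ} (hx : x < 0) : gammaPDFReal a r x = 0 :=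
  if_neg hx.not_ge

variable {W : Type*} [MeasurableSpace W] {P : Measure W} {X : W → ℝ}

theorem ae_pos_of_hasLaw_gammaMeasure {a r : ℝ} (hX : HasLaw X (gammaMeasure a r) P) :
    ∀ᵐ w ∂P, 0 < X w :=
  ae_pos_of_hasLaw_withDensity (measurable_gammaPDFReal a r)
    (fun _ => gammaPDFReal_of_neg a r) hX

theorem ae_pos_of_hasLaw_inverseGammaLaw {α g : ℝ} (hX : HasLaw X (inverseGammaLaw α g) P) :
    ∀ᵐ w ∂P, 0 < X w :=
  ae_pos_of_hasLaw_withDensity (measurable_inverseGammaPDF α g)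
    (fun _ => inverseGammaPDF_of_neg α g) hX

theorem hasComplexMoment_of_hasLaw_gammaMeasure {a r : ℝ} (ha : 0 < a) (hr : 0 < r)
    (hX : HasLaw X (gammaMeasure a r) P) {s : ℂ} (hs : s.re < a) :
    HasComplexMoment P X (-s) (Gamma (a - s) / (Real.Gamma a : ℂ) * (r : ℂ) ^ s) :=
  hasComplexMoment_of_hasLaw_withDensity (measurable_gammaPDFReal a r) (gammaPDFReal_nonneg ha hr)
    (fun _ => gammaPDFReal_of_neg a r) hX (hasMellin_gammaPDFReal hr hs)

theorem hasComplexMoment_of_hasLaw_inverseGammaLaw {α g : ℝ} (hα : 0 < α) (hg : 0 < g)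
    (hX : HasLaw X (inverseGammaLaw α g) P) {s : ℂ} (hs : -α < s.re) :
    HasComplexMoment P X (-s) (Gamma (α + s) / (Real.Gamma α : ℂ) * ((g⁻¹ : ℝ) : ℂ) ^ s) :=
  hasComplexMoment_of_hasLaw_withDensity (measurable_inverseGammaPDF α g)
    (inverseGammaPDF_nonneg hα hg) (fun _ => inverseGammaPDF_of_neg α g) hX
    (hasMellin_inverseGammaPDF hg hs)

end GammaLaws

section BitErrorProbability

theorem upperIncompleteGamma_one_half {y : ℝ} (hy : 0 ≤ y) :
    upperIncompleteGamma (1 / 2) y = 2 * ∫ x in Ioi √y, Real.exp (-x ^ 2) := by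
  rw [upperIncompleteGamma, ← integral_comp_rpow_Ioi_of_pos' two_pos hy, ← one_div,
    ← Real.sqrt_eq_rpow, ← integral_const_mul]
  refine setIntegral_congr_fun measurableSet_Ioi fun x hx => ?_
  have hx0 : 0 < x := (Real.sqrt_nonneg y).trans_lt hx
  have hinv : (x ^ (2 : ℝ)) ^ (1 / 2 - 1 : ℝ) = x⁻¹ := by
    rw [← Real.rpow_mul hx0.le, ← Real.rpow_neg_one]
    norm_num
  have hone : (2 - 1 : ℝ) = 1 := by norm_num
  rw [smul_eq_mul, hinv, hone, Real.rpow_one, Real.rpow_two]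
  field_simp

theorem gaussianQ_sqrt_two_mul (x : ℝ) :
    gaussianQ (√2 * x) = (√Real.pi)⁻¹ * ∫ t in Ioi x, Real.exp (-t ^ 2) := by
  rw [gaussianQ, measureReal_def, gaussianReal_apply_eq_integral _ one_ne_zero,
    ENNReal.toReal_ofReal (integral_nonneg fun x => gaussianPDFReal_nonneg _ _ _),
    ← integral_comp_mul_left_Ioi' _ _ (by positivity), smul_eq_mul, ← integral_const_mul,
    ← integral_const_mul]
  refine integral_congr_ae (.of_forall fun t => ?_)
  have hexp : -(√2 * t) ^ 2 / 2 = -t ^ 2 := by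
    rw [mul_pow, Real.sq_sqrt two_pos.le]
    ring
  simp only [gaussianPDFReal, NNReal.coe_one, sub_zero, hexp, mul_one,
    Real.sqrt_mul two_pos.le, mul_inv]
  rw [← mul_assoc, mul_inv_cancel_left₀ (by positivity)]

theorem gaussianQ_sqrt_eq_upperIncompleteGamma {y : ℝ} (hy : 0 ≤ y) :
    gaussianQ √(2 * y) = (2 * √Real.pi)⁻¹ * upperIncompleteGamma (1 / 2) y := by
  rw [Real.sqrt_mul two_pos.le, gaussianQ_sqrt_two_mul, upperIncompleteGamma_one_half hy]
  ring

variable {W : Type*} [MeasurableSpace W] {P : Measure W} {γ : W → ℝ}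

theorem bepBPSK_eq_integral_upperIncompleteGamma (hγ_pos : ∀ᵐ w ∂P, 0 < γ w) :
    bepBPSK P γ = (2 * √Real.pi)⁻¹ * ∫ w, upperIncompleteGamma (1 / 2) (γ w) ∂P := by
  rw [bepBPSK, ← integral_const_mul]
  refine integral_congr_ae ?_
  filter_upwards [hγ_pos] with w hw using gaussianQ_sqrt_eq_upperIncompleteGamma hw.le

theorem integral_cdf_mul [IsProbabilityMeasure P] {k : ℝ → ℝ} (hk : IntegrableOn k (Ioi 0))
    (hγ : AEMeasurable γ P) (hγ_pos : ∀ᵐ w ∂P, 0 < γ w) :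
    ∫ x in Ioi 0, cdf (P.map γ) x * k x = ∫ w, (∫ x in Ioi (γ w), k x) ∂P := by
  have := Measure.isProbabilityMeasure_map hγ
  let H : ℝ → W → ℝ := fun x w => (Ici (γ w)).indicator k x
  have hH : Integrable (Function.uncurry H) ((volume.restrict (Ioi 0)).prod P) := by
    have hset : NullMeasurableSet {q : ℝ × W | γ q.2 ≤ q.1} ((volume.restrict (Ioi 0)).prod P) :=
      nullMeasurableSet_le hγ.comp_snd measurable_fst.aemeasurable
    exact (Integrable.comp_fst hk P).indicator₀ hset
  have hcdf : ∀ x, cdf (P.map γ) x * k x = ∫ w, H x w ∂P := by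
    intro x
    have hfiber : H x = (γ ⁻¹' Iic x).indicator fun _ => k x := rfl
    rw [hfiber, integral_indicator₀ (hγ.nullMeasurable measurableSet_Iic), setIntegral_const,
      cdf_eq_real, map_measureReal_apply_of_aemeasurable hγ measurableSet_Iic, smul_eq_mul]
  simp only [hcdf]
  rw [integral_integral_swap hH]
  refine integral_congr_ae ?_
  filter_upwards [hγ_pos] with w hw
  rw [integral_indicator measurableSet_Ici, Measure.restrict_restrict measurableSet_Ici,
    inter_eq_left.2 (Ici_subset_Ioi.2 hw), integral_Ici_eq_integral_Ioi]

theorem integrableOn_cdf_mul (μ : Measure ℝ) [IsProbabilityMeasure μ] {k : ℝ → ℝ} {s : Set ℝ}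
    (hk : IntegrableOn k s) :
    IntegrableOn (fun x => cdf μ x * k x) s :=
  Integrable.bdd_mul (c := 1) hk (monotone_cdf μ).measurable.aestronglyMeasurable
    (.of_forall fun x => by
      rw [Real.norm_of_nonneg (cdf_nonneg μ x)]
      exact cdf_le_one μ x)

theorem bepIntegrand_eq (P : Measure W) (γ : W → ℝ) (x : ℝ) :
    bepIntegrand P γ x = cdf (P.map γ) x * (x ^ (1 / 2 - 1 : ℝ) * Real.exp (-x)) := by
  rw [bepIntegrand, mul_assoc]
  norm_num

theorem integrableOn_bepIntegrand [IsProbabilityMeasure P] (hγ : AEMeasurable γ P) :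
    IntegrableOn (bepIntegrand P γ) (Ioi 0) := by
  have := Measure.isProbabilityMeasure_map hγ
  simpa only [← bepIntegrand_eq] using integrableOn_cdf_mul (P.map γ)
    (integrableOn_rpow_mul_exp_neg one_half_pos)

theorem bepBPSK_eq_integral_bepIntegrand [IsProbabilityMeasure P] (hγ : AEMeasurable γ P)
    (hγ_pos : ∀ᵐ w ∂P, 0 < γ w) :
    bepBPSK P γ = (2 * √Real.pi)⁻¹ * ∫ x in Ioi 0, bepIntegrand P γ x := by
  simp only [bepBPSK_eq_integral_upperIncompleteGamma hγ_pos, bepIntegrand_eq,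
    integral_cdf_mul (integrableOn_rpow_mul_exp_neg one_half_pos) hγ hγ_pos, upperIncompleteGamma]

end BitErrorProbability

section MellinBarnes

variable {W : Type*} [MeasurableSpace W] {P : Measure W} {γ : W → ℝ} {a c : ℝ}
  {M : ℝ → ℂ}

theorem integrable_cpow_mul_Gamma_add_div (ha : 0 ≤ a) (hc : 0 < c) (hγ : AEMeasurable γ P)
    (hγ_pos : ∀ᵐ w ∂P, 0 < γ w) (hM : Integrable (fun w => (γ w : ℂ) ^ (-c : ℂ)) P) :
    Integrable (fun p : W × ℝ => (γ p.1 : ℂ) ^ (-(c + p.2 * I)) *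
      (Gamma (c + p.2 * I + a) / (c + p.2 * I))) (P.prod volume) := by
  have hΓ := verticalIntegrable_Gamma_add_div ha hc
  refine (hM.mul_prod hΓ).mono ?_ ?_
  · have : AEMeasurable (fun p : W × ℝ => γ p.1) (P.prod volume) := hγ.comp_fst
    exact AEStronglyMeasurable.mul (AEMeasurable.aestronglyMeasurable (by fun_prop))
      hΓ.aestronglyMeasurable.comp_snd
  · filter_upwards [Measure.quasiMeasurePreserving_fst.ae hγ_pos] with p hp
    simp only [norm_mul, norm_cpow_eq_rpow_re_of_pos hp]
    simp

theorem mellinBarnes_upperIncompleteGamma [SFinite P] (ha : 0 < a) (hc : 0 < c)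
    (hγ : AEMeasurable γ P) (hγ_pos : ∀ᵐ w ∂P, 0 < γ w)
    (hM : ∀ t : ℝ, HasComplexMoment P γ (-(c + t * I)) (M t)) :
    Integrable (fun t : ℝ => M t * (Gamma (c + t * I + a) / (c + t * I))) ∧
      (1 / (2 * Real.pi) : ℂ) * ∫ t : ℝ, M t * (Gamma (c + t * I + a) / (c + t * I)) =
        (∫ w, upperIncompleteGamma a (γ w) ∂P : ℝ) := by
  have hjoint := integrable_cpow_mul_Gamma_add_div ha.le hc hγ hγ_pos
    (by simpa using (hM 0).integrable)
  have hinner : ∀ t : ℝ, ∫ w, (γ w : ℂ) ^ (-(c + t * I)) * (Gamma (c + t * I + a) / (c + t * I)) ∂P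
      = M t * (Gamma (c + t * I + a) / (c + t * I)) := fun t => by
    rw [integral_mul_const, (hM t).integral_eq]
  simp only [← hinner]
  refine ⟨hjoint.integral_prod_right, ?_⟩
  rw [← integral_integral_swap hjoint, ← integral_const_mul, ← integral_complex_ofReal]
  refine integral_congr_ae ?_
  filter_upwards [hγ_pos] with w hw using integral_cpow_mul_Gamma_add_div ha hc hw

end MellinBarnes

section CascadedFading

/-- A cascade of independent fading and shadowing gains: the `X i` follow gamma laws with shape
`m i` and rate `r i`, the `Y j` follow inverse gamma laws with shape `α j` and scale `g j`. -/
structure CascadedFading {W ι κ : Type*} [MeasurableSpace W] (P : Measure W) (X : ι → W → ℝ)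
    (Y : κ → W → ℝ) (m r : ι → ℝ) (α g : κ → ℝ) : Prop where
  law_fading : ∀ i, HasLaw (X i) (gammaMeasure (m i) (r i)) P
  law_shadowing : ∀ j, HasLaw (Y j) (inverseGammaLaw (α j) (g j)) P
  indep : iIndepFun (Sum.elim X Y) P

/-- The received SNR of a cascade: the product of all its gains. -/
def cascadedSNR {W ι κ : Type*} [Fintype ι] [Fintype κ] (X : ι → W → ℝ) (Y : κ → W → ℝ)
    (w : W) : ℝ :=
  (∏ i, X i w) * ∏ j, Y j w

theorem cascadedSNR_eq_prod_elim {W ι κ : Type*} [Fintype ι] [Fintype κ] (X : ι → W → ℝ)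
    (Y : κ → W → ℝ) :
    cascadedSNR X Y = fun w => ∏ k, Sum.elim X Y k w := by
  ext w
  rw [cascadedSNR, Fintype.prod_sum_type]
  rfl

variable {W ι κ : Type*} [MeasurableSpace W] {P : Measure W}
  {X : ι → W → ℝ} {Y : κ → W → ℝ} {m r : ι → ℝ} {α g : κ → ℝ}

theorem CascadedFading.ae_pos_gain (h : CascadedFading P X Y m r α g) :
    ∀ k, ∀ᵐ w ∂P, 0 < Sum.elim X Y k w
  | .inl i => ae_pos_of_hasLaw_gammaMeasure (h.law_fading i)
  | .inr j => ae_pos_of_hasLaw_inverseGammaLaw (h.law_shadowing j)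

variable [Fintype ι] [Fintype κ]

theorem CascadedFading.aemeasurable_cascadedSNR (h : CascadedFading P X Y m r α g) :
    AEMeasurable (cascadedSNR X Y) P :=
  (Finset.aemeasurable_fun_prod _ fun i _ => (h.law_fading i).aemeasurable).mul
    (Finset.aemeasurable_fun_prod _ fun j _ => (h.law_shadowing j).aemeasurable)

theorem CascadedFading.ae_pos_cascadedSNR (h : CascadedFading P X Y m r α g) :
    ∀ᵐ w ∂P, 0 < cascadedSNR X Y w := by
  filter_upwards [ae_all_iff.2 h.ae_pos_gain] with w hw
  rw [cascadedSNR_eq_prod_elim]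
  exact Finset.prod_pos fun k _ => hw k

theorem CascadedFading.hasComplexMoment (h : CascadedFading P X Y m r α g) (hm : ∀ i, 0 < m i)
    (hr : ∀ i, 0 < r i) (hα : ∀ j, 0 < α j) (hg : ∀ j, 0 < g j) {s : ℂ} (hsα : ∀ j, -α j < s.re)
    (hsm : ∀ i, s.re < m i) :
    HasComplexMoment P (cascadedSNR X Y) (-s)
      (((1 / ((∏ i, Real.Gamma (m i)) * ∏ j, Real.Gamma (α j)) : ℝ) : ℂ)
        * ((∏ i, Gamma (m i - s)) * ∏ j, Gamma (α j + s))
        * (((∏ i, r i) / ∏ j, g j : ℝ) : ℂ) ^ s) := by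
  have hmoment : ∀ k, HasComplexMoment P (Sum.elim X Y k) (-s)
      (Sum.elim (fun i => Gamma (m i - s) / (Real.Gamma (m i) : ℂ) * (r i : ℂ) ^ s)
        (fun j => Gamma (α j + s) / (Real.Gamma (α j) : ℂ) * (((g j)⁻¹ : ℝ) : ℂ) ^ s) k)
    | .inl i => hasComplexMoment_of_hasLaw_gammaMeasure (hm i) (hr i) (h.law_fading i) (hsm i)
    | .inr j => hasComplexMoment_of_hasLaw_inverseGammaLaw (hα j) (hg j) (h.law_shadowing j)
        (hsα j)
  have hscale : (((∏ i, r i) / ∏ j, g j : ℝ) : ℂ) ^ s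
      = (∏ i, (r i : ℂ) ^ s) * ∏ j, (((g j)⁻¹ : ℝ) : ℂ) ^ s := by
    have hr_nonneg : ∀ i ∈ Finset.univ, 0 ≤ r i := fun i _ => (hr i).le
    have hg_nonneg : ∀ j ∈ Finset.univ, 0 ≤ (g j)⁻¹ := fun j _ => (inv_pos.2 (hg j)).le
    rw [div_eq_mul_inv, ← Finset.prod_inv_distrib, ofReal_mul,
      mul_cpow_ofReal_nonneg (Finset.prod_nonneg hr_nonneg) (Finset.prod_nonneg hg_nonneg),
      cpow_ofReal_prod _ hr_nonneg, cpow_ofReal_prod _ hg_nonneg]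
  rw [cascadedSNR_eq_prod_elim, hscale]
  convert hasComplexMoment_prod h.indep h.ae_pos_gain hmoment using 1
  simp only [Fintype.prod_sum_type, Sum.elim_inl, Sum.elim_inr, Finset.prod_mul_distrib,
    Finset.prod_div_distrib, ofReal_div, ofReal_one, ofReal_mul, ofReal_prod]
  ring

end CascadedFading

section MeijerG

/-- The upper parameters `1 - α₁, …, 1 - α_K, 1, 1/2` of the Meijer G-function of a cascade with
inverse gamma shapes `α`. -/
def upperParams {K : ℕ} (α : Fin K → ℝ) : List ℂ :=
  List.ofFn (fun j => 1 - (α j : ℂ)) ++ [1, 1 / 2]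

/-- The lower parameters `m₁, …, m_M, 0` of the Meijer G-function of a cascade with gamma
shapes `m`. -/
def lowerParams {M : ℕ} (m : Fin M → ℝ) : List ℂ :=
  List.ofFn (fun i => (m i : ℂ)) ++ [0]

variable {M K : ℕ} {m : Fin M → ℝ} {α : Fin K → ℝ}

theorem meijerSeparates_cascade_iff (hα : ∀ j, 0 < α j) {c : ℝ} :
    MeijerSeparates M (K + 2) (upperParams α) (lowerParams m) c ↔ 0 < c ∧ ∀ i, c < m i := by
  rw [MeijerSeparates, upperParams, lowerParams, List.take_left' List.length_ofFn,
    List.take_of_length_le (by simp)]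
  simp only [List.forall_mem_append, List.forall_mem_ofFn_iff, List.forall_mem_cons,
    List.not_mem_nil, false_implies, implies_true, and_true]
  constructor
  · rintro ⟨hm, -, h_one, -⟩
    exact ⟨by simpa using h_one 0, fun i => by simpa using hm i 0⟩
  · rintro ⟨hc, hm⟩
    refine ⟨fun i k => ?_, fun j k => ?_, fun k => ?_, fun k => ?_⟩
    · simpa using (hm i).trans_le (le_add_of_nonneg_right k.cast_nonneg)
    all_goals
      norm_num
      first | linarith [k.cast_nonneg (α := ℝ)] | linarith [k.cast_nonneg (α := ℝ), hα j]

theorem exists_meijerSeparates_cascade (hm : ∀ i, 0 < m i) (hα : ∀ j, 0 < α j) :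
    ∃ c, MeijerSeparates M (K + 2) (upperParams α) (lowerParams m) c := by
  simp only [meijerSeparates_cascade_iff hα]
  have hsmall : ∀ᶠ c : ℝ in 𝓝[>] 0, 0 < c ∧ ∀ i, c < m i :=
    eventually_mem_nhdsWithin.and (eventually_all.2 fun i =>
      eventually_nhdsWithin_of_eventually_nhds (eventually_lt_nhds (hm i)))
  exact hsmall.exists

theorem meijerIntegrand_cascade {z s : ℂ} (hs : 0 < s.re) :
    meijerIntegrand M (K + 2) (upperParams α) (lowerParams m) z s =
      (∏ i, Gamma (m i - s)) * (∏ j, Gamma (α j + s)) * z ^ s * (Gamma (s + 1 / 2) / s) := by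
  have hs0 : s ≠ 0 := ne_zero_of_re_pos hs
  have hΓ : Gamma s ≠ 0 := Gamma_ne_zero_of_re_pos hs
  have hΓ_one : Gamma (1 + s) = s * Gamma s := by rw [add_comm, Gamma_add_one _ hs0]
  have hhalf : (1 - 1 / 2 + s : ℂ) = s + 1 / 2 := by ring
  rw [meijerIntegrand, upperParams, lowerParams, List.take_left' List.length_ofFn,
    List.drop_left' List.length_ofFn, List.take_of_length_le (by simp),
    List.drop_of_length_le (by simp)]
  simp only [List.map_append, List.map_ofFn, List.prod_append, List.prod_ofFn, List.map_cons,
    List.map_nil, List.prod_cons, List.prod_nil, Function.comp_apply, sub_sub_cancel, sub_self,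
    sub_zero, zero_add, hΓ_one, hhalf]
  field_simp

variable {W : Type*} [MeasurableSpace W] {P : Measure W} {X : Fin M → W → ℝ} {Y : Fin K → W → ℝ}
  {r : Fin M → ℝ} {g : Fin K → ℝ}

theorem prod_Gamma_ne_zero {ι : Type*} [Fintype ι] {x : ι → ℝ} (hx : ∀ i, 0 < x i) :
    (∏ i, Real.Gamma (x i)) ≠ 0 :=
  Finset.prod_ne_zero_iff.2 fun i _ => (Real.Gamma_pos_of_pos (hx i)).ne'

theorem CascadedFading.mellinBarnes (h : CascadedFading P X Y m r α g) (hm : ∀ i, 0 < m i)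
    (hr : ∀ i, 0 < r i) (hα : ∀ j, 0 < α j) (hg : ∀ j, 0 < g j) {c : ℝ}
    (hc : MeijerSeparates M (K + 2) (upperParams α) (lowerParams m) c) :
    Integrable (fun t : ℝ => meijerIntegrand M (K + 2) (upperParams α) (lowerParams m)
      ((∏ i, r i) / ∏ j, g j : ℝ) (c + t * I)) ∧
    (1 / (2 * Real.pi) : ℂ) * ∫ t : ℝ, meijerIntegrand M (K + 2) (upperParams α) (lowerParams m)
      ((∏ i, r i) / ∏ j, g j : ℝ) (c + t * I) =
        ((∏ i, Real.Gamma (m i)) * (∏ j, Real.Gamma (α j))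
          * ∫ w, upperIncompleteGamma (1 / 2) (cascadedSNR X Y w) ∂P : ℝ) := by
  have := h.indep.isProbabilityMeasure
  obtain ⟨hc, hcm⟩ := (meijerSeparates_cascade_iff hα).1 hc
  have hre : ∀ t : ℝ, 0 < (c + t * I : ℂ).re := fun t => by simpa using hc
  obtain ⟨hint, heq⟩ := mellinBarnes_upperIncompleteGamma one_half_pos hc
    h.aemeasurable_cascadedSNR h.ae_pos_cascadedSNR fun t =>
      h.hasComplexMoment hm hr hα hg (fun j => (neg_neg_of_pos (hα j)).trans (hre t))
        (by simpa using hcm)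
  set D : ℝ := (∏ i, Real.Gamma (m i)) * ∏ j, Real.Gamma (α j)
  have hD : D ≠ 0 := mul_ne_zero (prod_Gamma_ne_zero hm) (prod_Gamma_ne_zero hα)
  have hhalf : ((1 / 2 : ℝ) : ℂ) = 1 / 2 := by norm_num
  simp only [hhalf, mul_assoc ((1 / D : ℝ) : ℂ), ← meijerIntegrand_cascade (hre _)]
    at hint heq
  refine ⟨(integrable_const_mul_iff (ofReal_ne_zero.2 (one_div_ne_zero hD)).isUnit _).1 hint, ?_⟩
  rw [integral_const_mul, mul_left_comm] at heq
  rw [ofReal_mul, ← heq, ← mul_assoc, ← ofReal_mul, mul_one_div_cancel hD, ofReal_one, one_mul]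

theorem CascadedFading.hasMeijerG (h : CascadedFading P X Y m r α g) (hm : ∀ i, 0 < m i)
    (hr : ∀ i, 0 < r i) (hα : ∀ j, 0 < α j) (hg : ∀ j, 0 < g j) :
    HasMeijerG M (K + 2) (upperParams α) (lowerParams m) ((∏ i, r i) / ∏ j, g j : ℝ)
      ((∏ i, Real.Gamma (m i)) * (∏ j, Real.Gamma (α j))
        * ∫ w, upperIncompleteGamma (1 / 2) (cascadedSNR X Y w) ∂P : ℝ) where
  exists_separates := exists_meijerSeparates_cascade hm hα
  integrable _ hc := (h.mellinBarnes hm hr hα hg hc).1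
  integral_eq _ hc := (h.mellinBarnes hm hr hα hg hc).2

end MeijerG

section Scenarios

theorem snrDS_eq_cascadedSNR {W : Type*} (N₁ N₂ I₁ I₂ : W → ℝ) :
    snrDS N₁ N₂ I₁ I₂ = cascadedSNR ![fun w => N₁ w ^ 2, fun w => N₂ w ^ 2] ![I₂, I₁] := by
  ext w
  simp only [snrDS, cascadedSNR, Fin.prod_univ_two, Matrix.cons_val_zero, Matrix.cons_val_one]
  ring

theorem snrSS_eq_cascadedSNR {W : Type*} (N₁ N₂ I : W → ℝ) :
    snrSS N₁ N₂ I = cascadedSNR ![fun w => N₁ w ^ 2, fun w => N₂ w ^ 2] ![I] := by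
  ext w
  simp only [snrSS, cascadedSNR, Fin.prod_univ_two, Fin.prod_univ_one, Matrix.cons_val_zero,
    Matrix.cons_val_one, mul_pow]

variable {W : Type*} [MeasurableSpace W] {P : Measure W} {N₁ N₂ : W → ℝ} {m₁ m₂ Ω : ℝ}

theorem DoubleShadowing.cascadedFading {I₁ I₂ : W → ℝ} {α₁ α₂ g₁ g₂ : ℝ}
    (h : DoubleShadowing P N₁ N₂ I₁ I₂ m₁ m₂ Ω α₁ α₂ g₁ g₂) :
    CascadedFading P ![fun w => N₁ w ^ 2, fun w => N₂ w ^ 2] ![I₂, I₁] ![m₁, m₂]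
      ![m₁ / Ω, m₂ / Ω] ![α₂, α₁] ![g₂, g₁] where
  law_fading := Fin.forall_fin_two.2 ⟨h.law_N₁, h.law_N₂⟩
  law_shadowing := Fin.forall_fin_two.2 ⟨h.law_I₂, h.law_I₁⟩
  indep := by
    have hindex : Function.Injective (Sum.elim ![0, 1] ![3, 2] : Fin 2 ⊕ Fin 2 → Fin 4) := by
      decide
    convert (h.indep.precomp hindex).comp (Sum.elim (fun _ x => x ^ 2) fun _ x => x)
      (by rintro (_ | _) <;> simp only [Sum.elim_inl, Sum.elim_inr] <;> fun_prop) with k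
    rcases k with k | k <;> fin_cases k <;> rfl

theorem SingleShadowing.cascadedFading {I : W → ℝ} {α g : ℝ}
    (h : SingleShadowing P N₁ N₂ I m₁ m₂ Ω α g) :
    CascadedFading P ![fun w => N₁ w ^ 2, fun w => N₂ w ^ 2] ![I] ![m₁, m₂]
      ![m₁ / Ω, m₂ / Ω] ![α] ![g] where
  law_fading := Fin.forall_fin_two.2 ⟨h.law_N₁, h.law_N₂⟩
  law_shadowing := Fin.forall_fin_one.2 h.law_I
  indep := by
    have hindex : Function.Injective (Sum.elim ![0, 1] ![2] : Fin 2 ⊕ Fin 1 → Fin 3) := by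
      decide
    convert (h.indep.precomp hindex).comp (Sum.elim (fun _ x => x ^ 2) fun _ x => x)
      (by rintro (_ | _) <;> simp only [Sum.elim_inl, Sum.elim_inr] <;> fun_prop) with k
    rcases k with k | k <;> fin_cases k <;> rfl

end Scenarios

theorem mainTheorem5_general {W : Type*} [MeasurableSpace W] {P : Measure W} {M K : ℕ}
    {X : Fin M → W → ℝ} {Y : Fin K → W → ℝ} {m r : Fin M → ℝ} {α g : Fin K → ℝ}
    (h : CascadedFading P X Y m r α g) (hm : ∀ i, 0 < m i) (hr : ∀ i, 0 < r i)
    (hα : ∀ j, 0 < α j) (hg : ∀ j, 0 < g j) :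
    IntegrableOn (bepIntegrand P (cascadedSNR X Y)) (Ioi 0) ∧
    bepBPSK P (cascadedSNR X Y) =
      (2 * √Real.pi)⁻¹ * ∫ x in Ioi (0 : ℝ), bepIntegrand P (cascadedSNR X Y) x ∧
    (∃ G : ℂ, HasMeijerG M (K + 2) (upperParams α) (lowerParams m) ((∏ i, r i) / ∏ j, g j : ℝ) G) ∧
    (bepBPSK P (cascadedSNR X Y) : ℂ) =
      ((1 / ((∏ i, Real.Gamma (m i)) * ∏ j, Real.Gamma (α j)) : ℝ) : ℂ)
        * (((2 * √Real.pi)⁻¹ : ℝ) : ℂ)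
        * meijerG M (K + 2) (upperParams α) (lowerParams m) ((∏ i, r i) / ∏ j, g j : ℝ) := by
  have := h.indep.isProbabilityMeasure
  have hG := h.hasMeijerG hm hr hα hg
  refine ⟨integrableOn_bepIntegrand h.aemeasurable_cascadedSNR,
    bepBPSK_eq_integral_bepIntegrand h.aemeasurable_cascadedSNR h.ae_pos_cascadedSNR, ⟨_, hG⟩, ?_⟩
  have hΓm := prod_Gamma_ne_zero hm
  have hΓα := prod_Gamma_ne_zero hα
  rw [hG.meijerG_eq, bepBPSK_eq_integral_upperIncompleteGamma h.ae_pos_cascadedSNR]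
  norm_cast
  field_simp

end

theorem mainTheorem5 {W : Type*} [MeasurableSpace W] (P : Measure W) [IsProbabilityMeasure P]
    (m₁ m₂ Ω : ℝ) (hm₁ : 0 < m₁) (hm₂ : 0 < m₂) (hΩ : 0 < Ω) :
    -- double shadowing
    (∀ (α₁ α₂ g₁ g₂ : ℝ), 1 < α₁ → 1 < α₂ → 0 < g₁ → 0 < g₂ →
      ∀ N₁ N₂ I₁ I₂ : W → ℝ, DoubleShadowing P N₁ N₂ I₁ I₂ m₁ m₂ Ω α₁ α₂ g₁ g₂ →
      IntegrableOn (bepIntegrand P (snrDS N₁ N₂ I₁ I₂)) (Set.Ioi 0) ∧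
      bepBPSK P (snrDS N₁ N₂ I₁ I₂) =
        (2 * √Real.pi)⁻¹ * ∫ x in Set.Ioi (0 : ℝ), bepIntegrand P (snrDS N₁ N₂ I₁ I₂) x ∧
      (∃ G : ℂ, HasMeijerG 2 4 [1 - (α₂ : ℂ), 1 - (α₁ : ℂ), 1, 1 / 2] [(m₁ : ℂ), (m₂ : ℂ), 0]
        ((m₁ * m₂ / (Ω ^ 2 * (g₁ * g₂)) : ℝ) : ℂ) G) ∧
      (bepBPSK P (snrDS N₁ N₂ I₁ I₂) : ℂ) =
        ((1 / (Real.Gamma m₁ * Real.Gamma m₂ * Real.Gamma α₁ * Real.Gamma α₂) : ℝ) : ℂ)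
          * (((2 * √Real.pi)⁻¹ : ℝ) : ℂ)
          * meijerG 2 4 [1 - (α₂ : ℂ), 1 - (α₁ : ℂ), 1, 1 / 2] [(m₁ : ℂ), (m₂ : ℂ), 0]
              ((m₁ * m₂ / (Ω ^ 2 * (g₁ * g₂)) : ℝ) : ℂ)) ∧
    -- single shadowing
    (∀ (α g : ℝ), 1 < α → 0 < g →
      ∀ N₁ N₂ I : W → ℝ, SingleShadowing P N₁ N₂ I m₁ m₂ Ω α g →
      IntegrableOn (bepIntegrand P (snrSS N₁ N₂ I)) (Set.Ioi 0) ∧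
      bepBPSK P (snrSS N₁ N₂ I) =
        (2 * √Real.pi)⁻¹ * ∫ x in Set.Ioi (0 : ℝ), bepIntegrand P (snrSS N₁ N₂ I) x ∧
      (∃ G : ℂ, HasMeijerG 2 3 [1 - (α : ℂ), 1, 1 / 2] [(m₁ : ℂ), (m₂ : ℂ), 0]
        ((m₁ * m₂ / (Ω ^ 2 * g) : ℝ) : ℂ) G) ∧
      (bepBPSK P (snrSS N₁ N₂ I) : ℂ) =
        ((1 / (Real.Gamma m₁ * Real.Gamma m₂ * Real.Gamma α) : ℝ) : ℂ)
          * (((2 * √Real.pi)⁻¹ : ℝ) : ℂ)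
          * meijerG 2 3 [1 - (α : ℂ), 1, 1 / 2] [(m₁ : ℂ), (m₂ : ℂ), 0]
              ((m₁ * m₂ / (Ω ^ 2 * g) : ℝ) : ℂ)) := by
  have hm : ∀ i, 0 < ![m₁, m₂] i := Fin.forall_fin_two.2 ⟨hm₁, hm₂⟩
  have hr : ∀ i, 0 < ![m₁ / Ω, m₂ / Ω] i := Fin.forall_fin_two.2 ⟨div_pos hm₁ hΩ, div_pos hm₂ hΩ⟩
  constructor
  · intro α₁ α₂ g₁ g₂ hα₁ hα₂ hg₁ hg₂ N₁ N₂ I₁ I₂ h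
    have hz : m₁ * m₂ / (Ω ^ 2 * (g₁ * g₂)) = m₁ / Ω * (m₂ / Ω) / (g₂ * g₁) := by field_simp
    have hS : Real.Gamma m₁ * Real.Gamma m₂ * Real.Gamma α₁ * Real.Gamma α₂ =
        Real.Gamma m₁ * Real.Gamma m₂ * (Real.Gamma α₂ * Real.Gamma α₁) := by ring
    rw [snrDS_eq_cascadedSNR, hz, hS]
    simpa [upperParams, lowerParams] using mainTheorem5_general h.cascadedFading hm hr
      (Fin.forall_fin_two.2 ⟨one_pos.trans hα₂, one_pos.trans hα₁⟩)
      (Fin.forall_fin_two.2 ⟨hg₂, hg₁⟩)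
  · intro α g hα hg N₁ N₂ I h
    have hz : m₁ * m₂ / (Ω ^ 2 * g) = m₁ / Ω * (m₂ / Ω) / g := by field_simp
    rw [snrSS_eq_cascadedSNR, hz]
    simpa [upperParams, lowerParams] using mainTheorem5_general h.cascadedFading hm hr
      (Fin.forall_fin_one.2 (one_pos.trans hα)) (Fin.forall_fin_one.2 hg)
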